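/- Let $n\ge 1$ and let $\mathcal L^n$ denote Lebesgue outer measure on $\mathbb R^n$. For $A,B\subset\mathbb R^n$ write $A\sim B$ if $\mathcal L^n(A\setminus B)=\mathcal L^n(B\setminus A)=0$. For $A\subset\mathbb R^n$ and a real number $m\ge n$, let $$A^{(m)}:=\Big\{x\in\mathbb R^n \;:\; \lim_{r\to0^+}\frac{\mathcal L^n(B(x,r)\setminus A)}{r^m}=0\Big\},$$ where $B(x,r)$ is the open ball of radius $r$ centred at $x$. The density-degree function $d_A:\mathbb R^n\to[0,+\infty]$ of $A$ is $$d_A(x):=\begin{cases}\sup\{m\in[n,+\infty) : x\in A^{(m)}\}&\text{if }x\in A^{(n)},\\ 0&\text{if }x\notin A^{(n)}.\end{cases}$$ The set $A$ is called uniformly $n$-dense if $A\sim\{x\in\mathbb R^n : d_A(x)=n\}$. **Corollary 5.1.** Let $E$ be a Lebesgue measurable subset of $\mathbb R^n$. Then there exists an increasing sequence $F_1\subset F_2\subset\cdots$ of uniformly $n$-dense closed subsets of $\mathbb R^n$ such that $\bigcup_{l}F_l\sim E$. -/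

import Mathlib

open MeasureTheory Filter Topology
open scoped ENNReal

namespace DensityDegree

/-- The set `E^{(m)}` of `m`-density points of `E ⊆ ℝⁿ`: those `x` for which
`ℒⁿ(B(x, r) ∖ E) / r^m → 0` as `r → 0⁺`. The set `E` is arbitrary; `volume` of a set that need not
be measurable is its Lebesgue outer measure. -/
def densityPoints {n : ℕ} (m : ℝ) (E : Set (EuclideanSpace ℝ (Fin n))) :
    Set (EuclideanSpace ℝ (Fin n)) :=
  {x | Tendsto (fun r : ℝ => volume (Metric.ball x r \ E) / ENNReal.ofReal (r ^ m))
    (𝓝[>] (0 : ℝ)) (𝓝 0)}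

open Classical in
/-- The density-degree function `d_E : ℝⁿ → [0, +∞]`: the supremum of all real `m ≥ n` such that
`x ∈ E^{(m)}` when `x ∈ E^{(n)}`, and `0` when `x ∉ E^{(n)}`. -/
noncomputable def densityDegree {n : ℕ} (E : Set (EuclideanSpace ℝ (Fin n)))
    (x : EuclideanSpace ℝ (Fin n)) : ℝ≥0∞ :=
  if x ∈ densityPoints (n : ℝ) E then
    sSup (ENNReal.ofReal '' {m : ℝ | (n : ℝ) ≤ m ∧ x ∈ densityPoints m E})
  else 0

/-- `E ⊆ ℝⁿ` is uniformly `k`-dense, for `k ∈ [n, +∞]`: the sets `E` and `{x | d_E(x) = k}` are equal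
up to a Lebesgue null set. -/
def IsUniformlyDense {n : ℕ} (k : ℝ≥0∞) (E : Set (EuclideanSpace ℝ (Fin n))) : Prop :=
  (n : ℝ≥0∞) ≤ k ∧ E =ᵐ[volume] {x | densityDegree E x = k}

end DensityDegree

/-!
Fix a coordinate `i`. For each `j ≥ 1`, thicken the hyperplanes `xᵢ ∈ 2⁻ʲ ℤ` to slabs of half-width
`2⁻ʲ / j²`. Multiplication by `2ʲ` preserves the measure of the circle `ℝ / ℤ`, so the `j`-th slab
occupies a fraction `O(1 / j²)` of the space and, by Borel–Cantelli, almost every point lies in only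
finitely many slabs. On the other hand every ball of radius `2⁻ʲ` with `j ≥ 2`
contains a ball of radius `2⁻ʲ / j²` inside the `j`-th slab, and `(2⁻ʲ / j²)ⁿ` eventually exceeds
`(2⁻ʲ)ᵐ` for every `m > n`. Hence a set avoiding all slabs with `j ≥ l` has no `m`-density points
for `m > n`; if it is measurable, the Lebesgue density theorem makes it uniformly
`n`-dense. It remains to remove the slabs with `j ≥ l` from the `l`-th member of an increasing
closed exhaustion of `E`.
-/

namespace DensityDegree

open Metric Set

section Exhaustion

variable {α : Type*} [MeasurableSpace α] {μ : Measure α}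

lemma exists_monotone_isClosed_iUnion_ae_eq [TopologicalSpace α] [OpensMeasurableSpace α]
    [SigmaFinite μ] [μ.WeaklyRegular] {E : Set α} (hE : NullMeasurableSet E μ) :
    ∃ K : ℕ → Set α, Monotone K ∧ (∀ l, IsClosed (K l)) ∧ (⋃ l, K l) =ᵐ[μ] E := by
  obtain ⟨A, -, hA, hAE⟩ := hE.exists_measurable_subset_ae_eq
  have hC (k : ℕ) : ∃ C ⊆ A ∩ spanningSets μ k, IsClosed C ∧
      μ ((A ∩ spanningSets μ k) \ C) < (k : ℝ≥0∞)⁻¹ :=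
    (hA.inter (measurableSet_spanningSets μ k)).exists_isClosed_sdiff_lt
      (measure_ne_top_of_subset inter_subset_right (measure_spanningSets_lt_top μ k).ne)
      (ENNReal.inv_ne_zero.2 (ENNReal.natCast_ne_top k))
  choose C hCA hC_closed hC_lt using hC
  have hC_subset : ⋃ k, C k ⊆ A := iUnion_subset fun k => (hCA k).trans inter_subset_left
  have hcover : A \ ⋃ k, C k = ⋃ N, (A ∩ spanningSets μ N) \ ⋃ k, C k := by
    rw [← iUnion_sdiff, ← inter_iUnion, iUnion_spanningSets, inter_univ]
  have hA_diff : μ (A \ ⋃ k, C k) = 0 := by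
    rw [hcover]
    refine measure_iUnion_null fun N => le_antisymm
      (ge_of_tendsto ENNReal.tendsto_inv_nat_nhds_zero ?_) zero_le
    filter_upwards [eventually_ge_atTop N] with k hNk
    calc μ ((A ∩ spanningSets μ N) \ ⋃ k, C k) ≤ μ ((A ∩ spanningSets μ k) \ C k) := by
          refine measure_mono (sdiff_subset_sdiff ?_ (subset_iUnion C k))
          exact inter_subset_inter_right A (monotone_spanningSets μ hNk)
      _ ≤ (k : ℝ≥0∞)⁻¹ := (hC_lt k).le
  refine ⟨accumulate C, monotone_accumulate,
    fun l => (finite_Iic l).isClosed_biUnion fun k _ => hC_closed k, EventuallyEq.trans ?_ hAE⟩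
  rw [iUnion_accumulate]
  exact hC_subset.eventuallyLE.antisymm (ae_le_set.2 hA_diff)

lemma iUnion_sdiff_ae_eq {ι : Type*} [Preorder ι] [IsDirectedOrder ι] {K U : ι → Set α}
    (hK : Monotone K) (hU : Antitone U) (hU_null : μ (⋂ l, U l) = 0) :
    (⋃ l, K l \ U l) =ᵐ[μ] ⋃ l, K l := by
  have h : ⋃ l, K l \ U l = (⋃ l, K l) \ ⋂ l, U l := by
    simp only [sdiff_eq, compl_iInter]
    exact iUnion_inter_of_monotone hK fun _ _ hab => compl_subset_compl.2 (hU hab)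
  rw [h]
  exact sdiff_null_ae_eq_self hU_null

end Exhaustion

section Circle

variable {T : ℝ} [Fact (0 < T)]

lemma volume_norm_nsmul_lt_le {q : ℕ} (hq : q ≠ 0) (δ : ℝ) :
    volume {t : AddCircle T | ‖q • t‖ < δ} ≤ ENNReal.ofReal (2 * δ) := by
  have hmp : MeasurePreserving (fun t : AddCircle T => q • t) volume volume := by
    simpa only [natCast_zsmul] using
      Measure.measurePreserving_zsmul (volume : Measure (AddCircle T)) (Int.natCast_ne_zero.2 hq)
  calc volume {t : AddCircle T | ‖q • t‖ < δ}
      = volume ((fun t : AddCircle T => q • t) ⁻¹' ball 0 δ) := by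
        simp only [preimage, mem_ball_zero_iff]
    _ = volume (ball (0 : AddCircle T) δ) :=
        hmp.measure_preimage measurableSet_ball.nullMeasurableSet
    _ ≤ volume (closedBall (0 : AddCircle T) δ) := measure_mono ball_subset_closedBall
    _ ≤ ENNReal.ofReal (2 * δ) := by
        rw [AddCircle.volume_closedBall]
        exact ENNReal.ofReal_le_ofReal (min_le_right _ _)

lemma ae_eventually_le_norm_nsmul {q : ℕ → ℕ} (hq : ∀ j, q j ≠ 0) {δ : ℕ → ℝ} (hδ : Summable δ) :
    ∀ᵐ t : AddCircle T, ∀ᶠ j in atTop, δ j ≤ ‖q j • t‖ := by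
  have hsum : ∑' j, volume {t : AddCircle T | ‖q j • t‖ < δ j} ≠ ∞ :=
    ne_top_of_le_ne_top (hδ.mul_left 2).tsum_ofReal_ne_top
      (ENNReal.tsum_le_tsum fun j => volume_norm_nsmul_lt_le (hq j) (δ j))
  simpa only [mem_ofPred_eq, not_lt] using ae_eventually_notMem hsum

lemma quasiMeasurePreserving_coe_addCircle :
    Measure.QuasiMeasurePreserving ((↑) : ℝ → AddCircle T) := by
  refine ⟨AddCircle.measurable_mk', Measure.AbsolutelyContinuous.mk fun s hs hs_null => ?_⟩
  rw [Measure.map_apply AddCircle.measurable_mk' hs, ← inter_univ (_ ⁻¹' s),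
    ← iUnion_Ioc_zsmul (Fact.out : 0 < T), inter_iUnion]
  refine measure_iUnion_null fun k => ?_
  rw [add_zsmul, one_zsmul]
  exact (AddCircle.add_projection_respects_measure T (k • T) hs).symm.trans hs_null

lemma exists_abs_sub_le_nsmul_coe_eq_zero {q : ℕ} (hq : q ≠ 0) (t : ℝ) :
    ∃ u : ℝ, |u - t| ≤ 1 / (2 * q) ∧ q • (u : UnitAddCircle) = 0 := by
  have hq_pos : (0 : ℝ) < q := by positivity
  refine ⟨round (q * t) / q, ?_, ?_⟩
  · have hround : round (q * t) / q - t = -(q * t - round (q * t)) / q := by field_simp; ring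
    rw [hround, abs_div, abs_neg, abs_of_pos hq_pos, div_le_div_iff₀ hq_pos (by positivity)]
    nlinarith [abs_sub_round (q * t)]
  · rw [← AddCircle.coe_nsmul, nsmul_eq_mul, mul_div_cancel₀ _ hq_pos.ne']
    exact (AddCircle.coe_eq_zero_iff 1).2 ⟨round (q * t), by simp⟩

end Circle

section Slabs

variable {ι : Type*}

/-- The slabs of points whose `i`-th coordinate is within `δ / q` of the grid `(1 / q) ℤ`, encoded
through the norm of the circle `ℝ / ℤ`, which is the distance to the nearest integer. -/
def gridSlab (i : ι) (q : ℕ) (δ : ℝ) : Set (EuclideanSpace ℝ ι) :=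
  {x | ‖q • (x i : UnitAddCircle)‖ < δ}

lemma isOpen_gridSlab (i : ι) (q : ℕ) (δ : ℝ) : IsOpen (gridSlab i q δ) := by
  have hcoe : Continuous fun x : EuclideanSpace ℝ ι => (x i : UnitAddCircle) :=
    (AddCircle.continuous_mk' 1).comp (by fun_prop)
  exact isOpen_lt (hcoe.const_smul q).norm continuous_const

lemma ae_eventually_notMem_gridSlab [Fintype ι] (i : ι) {q : ℕ → ℕ} (hq : ∀ j, q j ≠ 0) {δ : ℕ → ℝ}
    (hδ : Summable δ) : ∀ᵐ x, ∀ᶠ j in atTop, x ∉ gridSlab i (q j) (δ j) := by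
  have hcoe : Measure.QuasiMeasurePreserving
      (fun x : EuclideanSpace ℝ ι => (x i : UnitAddCircle)) :=
    quasiMeasurePreserving_coe_addCircle.comp
      ((Measure.quasiMeasurePreserving_eval (fun _ : ι => (volume : Measure ℝ)) i).comp
        (PiLp.volume_preserving_ofLp ι).quasiMeasurePreserving)
  simpa only [gridSlab, mem_ofPred_eq, not_lt] using hcoe.ae (ae_eventually_le_norm_nsmul hq hδ)

lemma exists_ball_subset_inter_gridSlab [Fintype ι] (i : ι) {q : ℕ} (hq : q ≠ 0) {δ : ℝ}
    (hδ : δ ≤ 1 / 2) (x : EuclideanSpace ℝ ι) :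
    ∃ y, ball y (δ / q) ⊆ ball x (1 / q) ∩ gridSlab i q δ := by
  classical
  obtain ⟨u, hu_dist, hu⟩ := exists_abs_sub_le_nsmul_coe_eq_zero hq (x i)
  have hq_pos : (0 : ℝ) < q := by positivity
  let y : EuclideanSpace ℝ ι := x + EuclideanSpace.single i (u - x i)
  have hyi : y i = u := by simp [y]
  have hyx : dist y x ≤ 1 / (2 * q) := by simpa [y, dist_eq_norm] using hu_dist
  refine ⟨y, fun z hz => ⟨?_, ?_⟩⟩
  · calc dist z x ≤ dist z y + dist y x := dist_triangle z y x
      _ < δ / q + 1 / (2 * q) := add_lt_add_of_lt_of_le hz hyx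
      _ ≤ (1 / 2) / q + 1 / (2 * q) := by gcongr
      _ = 1 / q := by field_simp; norm_num
  · have hzi : |z i - u| < δ / q := by
      rw [← hyi]
      exact (PiLp.norm_apply_le (z - y) i).trans_lt (mem_ball_iff_norm.1 hz)
    calc ‖q • (z i : UnitAddCircle)‖ = ‖q • ((z i - u : ℝ) : UnitAddCircle)‖ := by
          rw [AddCircle.coe_sub, nsmul_sub, hu, sub_zero]
      _ ≤ q * ‖((z i - u : ℝ) : UnitAddCircle)‖ := norm_nsmul_le
      _ ≤ q * |z i - u| := by gcongr; exact QuotientAddGroup.norm_mk_le_norm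
      _ < q * (δ / q) := by gcongr
      _ = δ := mul_div_cancel₀ δ hq_pos.ne'

/-- The union of the slabs at the scales `2⁻ʲ` with `j ≥ l`, of relative half-width `1 / j ^ 2`:
summable in `j`, yet subexponential. The slab with `j = 0` is empty, since `1 / 0 = 0`. -/
def dyadicSlabs (i : ι) (l : ℕ) : Set (EuclideanSpace ℝ ι) :=
  ⋃ j ≥ l, gridSlab i (2 ^ j) (1 / (j : ℝ) ^ 2)

lemma isOpen_dyadicSlabs (i : ι) (l : ℕ) : IsOpen (dyadicSlabs i l) :=
  isOpen_biUnion fun _ _ => isOpen_gridSlab i _ _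

lemma antitone_dyadicSlabs (i : ι) : Antitone (dyadicSlabs i) := fun _ _ hab =>
  biUnion_subset_biUnion_left fun _ hj => hab.trans hj

lemma volume_iInter_dyadicSlabs [Fintype ι] (i : ι) : volume (⋂ l, dyadicSlabs i l) = 0 := by
  rw [measure_eq_zero_iff_ae_notMem]
  filter_upwards [ae_eventually_notMem_gridSlab i (fun j => pow_ne_zero j two_ne_zero)
    (Real.summable_one_div_nat_pow.2 one_lt_two)] with x hx hmem
  obtain ⟨l, hl⟩ := eventually_atTop.1 hx
  obtain ⟨j, hlj, hj⟩ := mem_iUnion₂.1 (mem_iInter.1 hmem l)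
  exact hl j hlj hj

end Slabs

section Density

lemma ball_ae_eq_closedBall {V : Type*} [NormedAddCommGroup V] [NormedSpace ℝ V]
    [FiniteDimensional ℝ V] [MeasurableSpace V] [BorelSpace V] (μ : Measure V)
    [μ.IsAddHaarMeasure] (x : V) {r : ℝ} (hr : r ≠ 0) : ball x r =ᵐ[μ] closedBall x r := by
  rw [← closedBall_sdiff_sphere]
  exact sdiff_null_ae_eq_self (Measure.addHaar_sphere_of_ne_zero μ x hr)

variable {n : ℕ} {F : Set (EuclideanSpace ℝ (Fin n))} {x : EuclideanSpace ℝ (Fin n)} {m : ℝ}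

lemma ae_tendsto_volume_ball_sdiff_div (hF : MeasurableSet F) :
    ∀ᵐ x, Tendsto (fun r => volume (ball x r \ F) / ENNReal.ofReal (r ^ (n : ℝ))) (𝓝[>] 0)
      (𝓝 (Fᶜ.indicator 1 x * volume (ball (0 : EuclideanSpace ℝ (Fin n)) 1))) := by
  filter_upwards [Besicovitch.ae_tendsto_measure_inter_div_of_measurableSet volume hF.compl]
    with x hx
  set ω := volume (ball (0 : EuclideanSpace ℝ (Fin n)) 1)
  have hω_ne_zero : ω ≠ 0 := (measure_ball_pos _ _ one_pos).ne'
  have hω_ne_top : ω ≠ ∞ := measure_ball_lt_top.ne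
  refine (ENNReal.Tendsto.mul_const hx (Or.inr hω_ne_top)).congr' ?_
  filter_upwards [self_mem_nhdsWithin] with r (hr : 0 < r)
  have hball := ball_ae_eq_closedBall volume x hr.ne'
  have hsdiff : volume (Fᶜ ∩ closedBall x r) = volume (ball x r \ F) := by
    rw [sdiff_eq, inter_comm]
    exact measure_congr (hball.symm.inter (ae_eq_refl _))
  rw [hsdiff, ← measure_congr hball, Measure.addHaar_ball_of_pos _ x hr,
    finrank_euclideanSpace_fin, Real.rpow_natCast, ← ENNReal.mul_div_right_comm,
    ENNReal.mul_div_mul_right _ _ hω_ne_zero hω_ne_top]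

lemma densityPoints_ae_eq (hF : MeasurableSet F) : densityPoints (n : ℝ) F =ᵐ[volume] F := by
  filter_upwards [ae_tendsto_volume_ball_sdiff_div hF] with x hx
  have hω_ne_zero : volume (ball (0 : EuclideanSpace ℝ (Fin n)) 1) ≠ 0 :=
    (measure_ball_pos _ _ one_pos).ne'
  refine propext ⟨fun hxD => ?_, fun hxF => ?_⟩
  · have hlimit := tendsto_nhds_unique hx hxD
    by_contra hxF
    exact hω_ne_zero (by simpa [indicator_of_mem (mem_compl hxF)] using hlimit)
  · rw [indicator_of_notMem (notMem_compl_iff.2 hxF), zero_mul] at hx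
    exact hx

lemma notMem_densityPoints_of_frequently_ball_subset
    (h : ∃ᶠ r in 𝓝[>] (0 : ℝ), ∃ y, ∃ s > 0, r ^ m ≤ s ^ n ∧ ball y s ⊆ ball x r \ F) :
    x ∉ densityPoints m F := by
  intro hx
  set ω := volume (ball (0 : EuclideanSpace ℝ (Fin n)) 1)
  have hω_pos : 0 < ω := measure_ball_pos _ _ one_pos
  obtain ⟨r, ⟨y, s, hs, hrs, hsub⟩, hlt, hr : 0 < r⟩ :=
    (h.and_eventually ((hx.eventually_lt_const hω_pos).and self_mem_nhdsWithin)).exists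
  refine hlt.not_ge ?_
  rw [ENNReal.le_div_iff_mul_le (Or.inl (ENNReal.ofReal_pos.2 (by positivity)).ne')
    (Or.inl ENNReal.ofReal_ne_top)]
  calc ω * ENNReal.ofReal (r ^ m) ≤ ω * ENNReal.ofReal (s ^ n) := by gcongr
    _ = volume (ball y s) := by
        rw [Measure.addHaar_ball_of_pos _ y hs, finrank_euclideanSpace_fin, mul_comm]
    _ ≤ volume (ball x r \ F) := measure_mono hsub

lemma densityDegree_eq_natCast (hx : x ∈ densityPoints (n : ℝ) F)
    (hgt : ∀ m : ℝ, n < m → x ∉ densityPoints m F) : densityDegree F x = n := by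
  have hset : {m : ℝ | n ≤ m ∧ x ∈ densityPoints m F} = {(n : ℝ)} := by
    refine eq_singleton_iff_unique_mem.2 ⟨⟨le_rfl, hx⟩, fun m ⟨hnm, hm⟩ => ?_⟩
    exact (hnm.eq_or_lt.resolve_right fun h => hgt m h hm).symm
  rw [densityDegree, if_pos hx, hset, image_singleton, sSup_singleton, ENNReal.ofReal_natCast]

lemma isUniformlyDense_natCast_of_ae (hn : n ≠ 0) (hF : MeasurableSet F)
    (hgt : ∀ᵐ x, x ∈ F → ∀ m : ℝ, n < m → x ∉ densityPoints m F) :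
    IsUniformlyDense (n : ℝ≥0∞) F := by
  refine ⟨le_rfl, ?_⟩
  filter_upwards [densityPoints_ae_eq hF, hgt] with x hxD hx
  have hiff : x ∈ densityPoints (n : ℝ) F ↔ x ∈ F := iff_of_eq hxD
  refine propext ⟨fun hxF => densityDegree_eq_natCast (hiff.2 hxF) (hx hxF), fun hdeg => ?_⟩
  by_contra hxF
  have hzero : densityDegree F x = 0 := if_neg (mt hiff.1 hxF)
  exact hn (Nat.cast_eq_zero.1 (hdeg.symm.trans hzero))

lemma eventually_rpow_le_pow_div_sq (hm : n < m) :
    ∀ᶠ j : ℕ in atTop, (1 / 2 ^ j : ℝ) ^ m ≤ (1 / (j : ℝ) ^ 2 / 2 ^ j) ^ n := by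
  have hbase : (1 : ℝ) < 2 ^ (m - n) := Real.one_lt_rpow one_lt_two (sub_pos.2 hm)
  filter_upwards [(isLittleO_pow_const_const_pow_of_one_lt (R := ℝ) (2 * n) hbase).bound one_pos,
    eventually_gt_atTop 0] with j hj hj_pos
  have hj' : ((j : ℝ) ^ 2) ^ n ≤ ((2 : ℝ) ^ (m - n)) ^ j := by
    simpa [pow_mul, abs_of_pos, Real.rpow_pos_of_pos] using hj
  have hsplit : ((2 : ℝ) ^ j) ^ m = ((2 : ℝ) ^ (m - n)) ^ j * (2 ^ j) ^ n := by
    rw [Real.rpow_pow_comm two_pos.le, ← Real.rpow_natCast _ n, ← Real.rpow_add (by positivity),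
      sub_add_cancel]
  rw [Real.div_rpow zero_le_one (by positivity), Real.one_rpow, div_div, div_pow, one_pow, mul_pow,
    hsplit]
  gcongr

lemma notMem_densityPoints_of_disjoint_dyadicSlabs (i : Fin n) {l : ℕ}
    (hd : Disjoint F (dyadicSlabs i l)) (hm : n < m) : x ∉ densityPoints m F := by
  have hradius : Tendsto (fun j : ℕ => (1 / 2 ^ j : ℝ)) atTop (𝓝[>] 0) := by
    simpa only [one_div, inv_pow] using
      tendsto_pow_atTop_nhdsWithin_zero_of_lt_one (r := (2⁻¹ : ℝ)) (by norm_num) (by norm_num)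
  refine notMem_densityPoints_of_frequently_ball_subset
    (hradius.frequently (Eventually.frequently ?_))
  filter_upwards [eventually_rpow_le_pow_div_sq hm, eventually_ge_atTop l, eventually_ge_atTop 2]
    with j hpow hlj hj
  have hj' : (2 : ℝ) ≤ j := by exact_mod_cast hj
  have hδ : 1 / (j : ℝ) ^ 2 ≤ 1 / 2 := by gcongr; nlinarith
  obtain ⟨y, hy⟩ := exists_ball_subset_inter_gridSlab i (pow_ne_zero j two_ne_zero) hδ x
  push_cast at hy
  refine ⟨y, 1 / (j : ℝ) ^ 2 / 2 ^ j, by positivity, hpow, fun z hz => ⟨(hy hz).1, ?_⟩⟩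
  exact hd.notMem_of_mem_right (mem_iUnion₂.2 ⟨j, hlj, (hy hz).2⟩)

end Density

end DensityDegree

theorem corollary5p1 (n : ℕ) (hn : 1 ≤ n) (E : Set (EuclideanSpace ℝ (Fin n)))
    (hE : NullMeasurableSet E volume) :
    ∃ F : ℕ → Set (EuclideanSpace ℝ (Fin n)),
      Monotone F ∧
      (∀ l, IsClosed (F l)) ∧
      (∀ l, DensityDegree.IsUniformlyDense (n : ℝ≥0∞) (F l)) ∧
      (⋃ l, F l) =ᵐ[volume] E := by
  obtain ⟨K, hK_mono, hK_closed, hKE⟩ :=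
    DensityDegree.exists_monotone_isClosed_iUnion_ae_eq hE
  let i : Fin n := ⟨0, hn⟩
  let U := DensityDegree.dyadicSlabs i
  have hU_anti : Antitone U := DensityDegree.antitone_dyadicSlabs i
  have hF_closed (l : ℕ) : IsClosed (K l \ U l) :=
    (hK_closed l).sdiff (DensityDegree.isOpen_dyadicSlabs i l)
  refine ⟨fun l => K l \ U l, fun a b hab => Set.sdiff_subset_sdiff (hK_mono hab) (hU_anti hab),
    hF_closed, fun l => ?_, ?_⟩
  · refine DensityDegree.isUniformlyDense_natCast_of_ae (Nat.one_le_iff_ne_zero.1 hn)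
      (hF_closed l).measurableSet (.of_forall fun x _ m hm => ?_)
    exact DensityDegree.notMem_densityPoints_of_disjoint_dyadicSlabs i Set.disjoint_sdiff_left hm
  · have hU_null : volume (⋂ l, U l) = 0 := DensityDegree.volume_iInter_dyadicSlabs i
    exact (DensityDegree.iUnion_sdiff_ae_eq hK_mono hU_anti hU_null).trans hKE
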